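/- Identify binary vectors in $\{0,1\}^n$ with their supports. Let $A$ be an $M\times N$ binary matrix; for $x\in\{0,1\}^N$ let $A[x]\in\{0,1\}^M$ be the bitwise OR of the columns of $A$ selected by the support of $x$. A pair $(x,y)$ of binary vectors of equal length is $(a,b)$-close if $y$ is obtained from $x$ by flipping at most $a$ bits from $0$ to $1$ and at most $b$ bits from $1$ to $0$; otherwise it is $(a,b)$-far. A vector is $D$-sparse if it has at most $D$ nonzero coordinates. For $y\in\{0,1\}^M$, a vector $z\in\{0,1\}^N$ is a valid decoding of $y$ (with parameters $(e_0,e_1,e_0',e_1')$, for $D$-sparse vectors) if for every $D$-sparse $x\in\{0,1\}^N$ such that $(x,z)$ is $(e_0',e_1')$-far, $(A[x],y)$ is $(e_0,e_1)$-far. The matrix $A$ is $(e_0,e_1,e_0',e_1')$-correcting for $D$-sparse vectors if every $y\in\{0,1\}^M$ has a valid decoding. **Corollary.** For every constant $\delta>0$ there are constants $C,c,p,\nu>0$ and an algorithm $R$ (a Turing machine with finitely many stacks), all depending only on $\delta$, such that for all integers $N\ge 2$ and $1\le D\le N$ there is an $M\times N$ binary matrix $A$ with $M\le C\,D\log N$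 that is $(pM,\,(\nu/D)M,\,\delta D,\,0)$-correcting for $D$-sparse vectors of length $N$; moreover, on input $A$ (listed column by column) and any $y\in\{0,1\}^M$, the algorithm $R$ outputs a valid decoding of $y$ with these parameters in at most $c\,MN$ steps. -/

import Mathlib

namespace GroupTesting

/-- `(x, y)` are `(e₀, e₁)`-close: `y` is obtained from `x` by flipping at most `e₀` bits from
`0` to `1` and at most `e₁` bits from `1` to `0`. The bounds are real numbers, so that
`p * m` can be used directly; a count is at most `e` iff it is at most the integer part of `e`. -/
def IsClose {n : ℕ} (e₀ e₁ : ℝ) (x y : Fin n → Bool) : Prop :=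
  ((Finset.univ.filter fun i => x i = false ∧ y i = true).card : ℝ) ≤ e₀ ∧
  ((Finset.univ.filter fun i => x i = true ∧ y i = false).card : ℝ) ≤ e₁

/-- The number of nonzero coordinates is at most `d`. -/
def IsSparse {n : ℕ} (d : ℕ) (x : Fin n → Bool) : Prop :=
  (Finset.univ.filter fun j => x j = true).card ≤ d

/-- The outcome `A[x]` of the measurements: the bitwise OR of the columns of `A` that are chosen
by the support of `x`. -/
def outcome {m n : ℕ} (A : Matrix (Fin m) (Fin n) Bool) (x : Fin n → Bool) : Fin m → Bool :=
  fun i => decide (∃ j, x j = true ∧ A i j = true)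

/-- `z` is a valid decoding of `y`: every `d`-sparse `x` that is `(e₀', e₁')`-far from `z` has an
outcome that is `(e₀, e₁)`-far from `y`. -/
def IsValidDecoding {m n : ℕ} (A : Matrix (Fin m) (Fin n) Bool) (d : ℕ) (e₀ e₁ e₀' e₁' : ℝ)
    (y : Fin m → Bool) (z : Fin n → Bool) : Prop :=
  ∀ x : Fin n → Bool, IsSparse d x → ¬ IsClose e₀' e₁' x z → ¬ IsClose e₀ e₁ (outcome A x) y

/-- `A` is `(e₀, e₁, e₀', e₁')`-correcting for `d`-sparse vectors. -/
def IsCorrecting {m n : ℕ} (A : Matrix (Fin m) (Fin n) Bool) (d : ℕ)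
    (e₀ e₁ e₀' e₁' : ℝ) : Prop :=
  ∀ y : Fin m → Bool, ∃ z : Fin n → Bool, IsValidDecoding A d e₀ e₁ e₀' e₁' y z

/-- A bit vector written over the alphabet `{0, 1, #}` (`#` is `none`), closed by the
separator `#`. -/
def encodeVec {m : ℕ} (v : Fin m → Bool) : List (Option Bool) :=
  (List.ofFn v).map some ++ [none]

/-- The input of a reconstruction algorithm: the observed outcome `y`, followed by the columns of
the measurement matrix `A`. -/
def encodeInput {m n : ℕ} (A : Matrix (Fin m) (Fin n) Bool) (y : Fin m → Bool) :
    List (Option Bool) :=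
  encodeVec y ++ (List.ofFn fun j => encodeVec fun i => A i j).flatten

/-- An algorithm that reads words over `{0, 1, #}` and writes words over `{0, 1}`: a machine with
finitely many stacks, labels and internal states. Each step runs one labelled block of the
program, which consists of a bounded number of elementary stack operations. -/
abbrev Algorithm : Type 1 := Turing.TM2ComputableAux (Option Bool) Bool

/-- On the word `w`, the algorithm `R` halts with output `w'` after at most `t` steps. -/
def OutputsWithin (R : Algorithm) (w : List (Option Bool)) (w' : List Bool) (t : ℕ) : Prop :=
  Nonempty (Turing.TM2OutputsInTime R.tm (w.map R.inputAlphabet.symm)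
    (some (w'.map R.outputAlphabet.symm)) t)

/-- Given `A` and any observed outcome `y`, the algorithm `R` outputs a valid decoding of `y`
within `t` steps. -/
def Reconstructs (R : Algorithm) {m n : ℕ} (A : Matrix (Fin m) (Fin n) Bool) (d : ℕ)
    (e₀ e₁ e₀' e₁' : ℝ) (t : ℕ) : Prop :=
  ∀ y : Fin m → Bool, ∃ z : Fin n → Bool, IsValidDecoding A d e₀ e₁ e₀' e₁' y z ∧
    OutputsWithin R (encodeInput A y) (List.ofFn z) t

end GroupTesting

/-! The rows of `A` form `m = O(log N)` blocks of `k * 4 ^ E` rows, where `k = D + s` and `s = ⌊δ D⌋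
+ 1`. In block `i` each column has a single one, placed by a function `F i`. Random `F i` form a
lossless expander with positive probability (`exists_few_collisions`): any at most `k` columns have
almost disjoint supports.

Decoding is by majority vote in each column (`isValidDecoding_majorityDecoding`). Rejecting a column
of `x` takes more than `m / 2` flips from 1 to 0. If `s` columns outside `x` were accepted,
expansion would give them more than `3 m s / 4` rows outside those of `x`. At most `m s / 2` of
these are missing from `y`, so more than `m s / 4` are flips from 0 to 1, which exceeds the
allowance. The vote runs in linear time on a stack machine (`runs_decode`). -/

namespace GroupTesting

open Finset

/-! ### Lossless expanders from random functions. -/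

section Expander

variable {α β : Type*} [Fintype α] [DecidableEq α] [Fintype β]

/-- Exchanging `v` with `f a` is an involution on pairs `(f, v)`: resampling one value of a uniform
function leaves it uniform. -/
theorem sum_sum_update (a : α) (g : (α → β) → ℕ) :
    ∑ f : α → β, ∑ v : β, g (Function.update f a v) = Fintype.card β * ∑ f : α → β, g f := by
  have hinv : Function.Involutive
      (fun x : (α → β) × β => (Function.update x.1 a x.2, x.1 a)) := by
    rintro ⟨f, v⟩
    simp
  have h := Equiv.sum_comp hinv.toPerm (fun x : (α → β) × β => g x.1)
  rw [Fintype.sum_prod_type, Fintype.sum_prod_type] at h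
  simpa [mul_sum] using h

variable [DecidableEq β]

/-- The exponential moment of the number of collisions of a random function on the set `T`. -/
theorem sum_pow_collisions_le (T : Finset α) (k b : ℕ) (hT : #T ≤ k) (hb : 0 < b)
    (hβ : Fintype.card β = k * b) :
    ∑ f : α → β, b ^ (#T - #(T.image f)) ≤ Fintype.card (α → β) * 2 ^ #T := by
  induction T using Finset.induction_on with
  | empty => simp
  | insert a T ha ih =>
    rw [card_insert_of_notMem ha] at hT ⊢
    have hk : 0 < k * b := Nat.mul_pos (by omega) hb
    -- Of the `k * b` values at `a`, at most `k` collide with the image of `T`. Each of these weighs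
    -- an extra factor `b`, so a new point at most doubles the moment.
    have key : ∀ f : α → β,
        ∑ v : β, b ^ (#T + 1 - #((insert a T).image (Function.update f a v))) ≤
          2 * (k * b) * b ^ (#T - #(T.image f)) := by
      intro f
      have himg : ∀ v, (insert a T).image (Function.update f a v) = insert v (T.image f) := by
        intro v
        rw [image_insert, Function.update_self]
        congr 1
        refine image_congr fun x hx => ?_
        rw [Function.update_of_ne]
        rintro rfl
        exact ha hx
      have hle : #(T.image f) ≤ #T := card_image_le
      have hterm : ∀ v, b ^ (#T + 1 - #((insert a T).image (Function.update f a v))) ≤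
          (if v ∈ T.image f then b else 0) * b ^ (#T - #(T.image f)) +
            b ^ (#T - #(T.image f)) := by
        intro v
        rw [himg]
        by_cases hv : v ∈ T.image f
        · rw [insert_eq_self.2 hv, if_pos hv, Nat.sub_add_comm hle, pow_succ']
          exact Nat.le_add_right _ _
        · rw [card_insert_of_notMem hv, if_neg hv, Nat.add_sub_add_right]
          simp
      calc _ ≤ ∑ v : β, ((if v ∈ T.image f then b else 0) * b ^ (#T - #(T.image f)) +
            b ^ (#T - #(T.image f))) := sum_le_sum fun v _ => hterm v
        _ = (#(T.image f) * b + k * b) * b ^ (#T - #(T.image f)) := by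
          rw [sum_add_distrib, ← sum_mul, sum_ite_mem, univ_inter, sum_const, sum_const,
            card_univ, hβ, smul_eq_mul, smul_eq_mul]
          ring
        _ ≤ _ := by
          gcongr
          rw [two_mul]
          gcongr
          omega
    have h := sum_le_sum fun f (_ : f ∈ (univ : Finset (α → β))) => key f
    rw [sum_sum_update a fun f => b ^ (#T + 1 - #((insert a T).image f)), hβ, ← mul_sum] at h
    refine Nat.le_of_mul_le_mul_left (h.trans ?_) hk
    calc _ ≤ 2 * (k * b) * (Fintype.card (α → β) * 2 ^ #T) := by
          gcongr
          exact ih (by omega)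
      _ = _ := by ring

/-- Markov's inequality for the number of collisions of `m` independent random functions. -/
theorem card_many_collisions_le (T : Finset α) (m k E : ℕ) (hT : #T ≤ k)
    (hβ : Fintype.card β = k * 4 ^ E) :
    #{F : Fin m → α → β | m * #T ≤ E * ∑ i, (#T - #(T.image (F i)))} * 2 ^ (m * #T) ≤
      Fintype.card (Fin m → α → β) := by
  have h1 := Nat.pow_le_pow_left
    (sum_pow_collisions_le (β := β) T k (4 ^ E) hT (by positivity) hβ) m
  rw [Fintype.sum_pow] at h1
  -- A bad family contributes at least `4 ^ (m * #T)`, while the average is at most `2 ^ (m * #T)`.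
  have h2 : #{F : Fin m → α → β | m * #T ≤ E * ∑ i, (#T - #(T.image (F i)))} * 4 ^ (m * #T) ≤
      ∑ F : Fin m → α → β, ∏ i, (4 ^ E) ^ (#T - #(T.image (F i))) := by
    rw [← smul_eq_mul, ← sum_const]
    refine (sum_le_sum fun F hF => ?_).trans (sum_le_univ_sum_of_nonneg fun _ => Nat.zero_le _)
    rw [prod_pow_eq_pow_sum, ← pow_mul]
    exact Nat.pow_le_pow_right (by norm_num) (mem_filter.1 hF).2
  have h3 : (4 : ℕ) ^ (m * #T) = 2 ^ (m * #T) * 2 ^ (m * #T) := by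
    rw [← mul_pow]; rfl
  have h4 := h2.trans h1
  rw [h3, ← mul_assoc, mul_pow, ← pow_mul, mul_comm (#T) m] at h4
  have h5 := Nat.le_of_mul_le_mul_right h4 (by positivity)
  simpa using h5

/-- A lossless expander: `m` functions that together have few collisions on every small set. -/
theorem exists_few_collisions (m k E : ℕ) (hk : 0 < k) (hm : 2 * Fintype.card α ≤ 2 ^ m)
    (hβ : Fintype.card β = k * 4 ^ E) :
    ∃ F : Fin m → α → β, ∀ T : Finset α, T.Nonempty → #T ≤ k →
      E * ∑ i, (#T - #(T.image (F i))) < m * #T := by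
  by_contra! hcon
  let bad (T : Finset α) : Finset (Fin m → α → β) :=
    {F : Fin m → α → β | m * #T ≤ E * ∑ i, (#T - #(T.image (F i)))}
  have : Nonempty β := Fintype.card_pos_iff.1 (by rw [hβ]; positivity)
  have hpos : (0 : ℝ) < Fintype.card (Fin m → α → β) := by exact_mod_cast Fintype.card_pos
  have hcover : (univ : Finset (Fin m → α → β)) ⊆
      ({T : Finset α | T.Nonempty ∧ #T ≤ k} : Finset (Finset α)).biUnion bad := by
    intro F _
    obtain ⟨T, h1, h2, h3⟩ := hcon F
    exact mem_biUnion.2 ⟨T, by simp [h1, h2], by simp [bad, h3]⟩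
  have hcard := (card_le_card hcover).trans card_biUnion_le
  have hbad : ∀ T : Finset α, #T ≤ k →
      (#(bad T) : ℝ) ≤ Fintype.card (Fin m → α → β) * ((1 / 2) ^ m) ^ #T := by
    intro T hT
    have h := card_many_collisions_le (β := β) T m k E hT hβ
    rw [← pow_mul, one_div, inv_pow, ← div_eq_mul_inv, le_div_iff₀ (by positivity)]
    exact_mod_cast h
  have hsum : (Fintype.card (Fin m → α → β) : ℝ) ≤
      Fintype.card (Fin m → α → β) *
        ∑ T ∈ ({T : Finset α | T.Nonempty ∧ #T ≤ k} : Finset (Finset α)), ((1 / 2) ^ m) ^ #T := by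
    rw [mul_sum]
    refine le_trans ?_ (sum_le_sum fun T hT => hbad T (mem_filter.1 hT).2.2)
    exact_mod_cast hcard
  have hone := (le_mul_iff_one_le_right hpos).1 hsum
  -- Union bound: the sum over all `T` is binomial and at most `exp (1 / 2) < 2`. The empty set
  -- accounts for 1, so less than 1 remains.
  have hall : ∑ T : Finset α, (((1 / 2 : ℝ)) ^ m) ^ #T = ((1 / 2) ^ m + 1) ^ Fintype.card α := by
    have := sum_pow_mul_eq_add_pow ((1 / 2 : ℝ) ^ m) 1 (univ : Finset α)
    simpa using this
  have hle : ∑ T ∈ ({T : Finset α | T.Nonempty ∧ #T ≤ k} : Finset (Finset α)),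
      ((1 / 2 : ℝ) ^ m) ^ #T + 1 ≤ ∑ T : Finset α, (((1 / 2 : ℝ)) ^ m) ^ #T := by
    rw [← sum_erase_add univ _ (mem_univ (∅ : Finset α)), card_empty, pow_zero]
    gcongr
    intro T hT
    simp only [mem_filter, mem_univ, true_and] at hT
    simp [hT.1.ne_empty]
  have hexp : ((1 / 2 : ℝ) ^ m + 1) ^ Fintype.card α ≤ Real.exp (1 / 2) := by
    have h1 : (1 / 2 : ℝ) ^ m + 1 ≤ Real.exp ((1 / 2) ^ m) := Real.add_one_le_exp _
    refine (pow_le_pow_left₀ (by positivity) h1 _).trans ?_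
    rw [← Real.exp_nat_mul, Real.exp_le_exp, one_div, inv_pow, ← div_eq_mul_inv,
      div_le_iff₀ (by positivity)]
    have : (2 * Fintype.card α : ℝ) ≤ 2 ^ m := by exact_mod_cast hm
    linarith
  have he : Real.exp (1 / 2) < 2 := by
    have h1 : Real.exp (1 / 2) * Real.exp (1 / 2) = Real.exp 1 := by
      rw [← Real.exp_add]; norm_num
    nlinarith [Real.exp_one_lt_three, Real.exp_pos (1 / 2)]
  linarith

end Expander

end GroupTesting

/-! ### The majority decoder as a stack machine, with its running time. -/

namespace GroupTesting

open Turing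

namespace MajorityDecoder

/-- The stacks: `outcome` holds the unread bits of the observed outcome and `seen` the ones that
were read; `covered` and `uncovered` count in unary the nonzero entries of the current column;
`decoded` collects the answers in reverse order. -/
inductive Stack
  | input | output | outcome | seen | covered | uncovered | decoded
  deriving DecidableEq

instance : Fintype Stack where
  elems := {.input, .output, .outcome, .seen, .covered, .uncovered, .decoded}
  complete := by rintro (_ | _) <;> decide

abbrev Alphabet : Stack → Type
  | .input => Option Bool
  | _ => Bool

inductive Label
  | load | rewind | scan | discard | emit
  deriving DecidableEq

instance : Fintype Label where
  elems := {.load, .rewind, .scan, .discard, .emit}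
  complete := by rintro (_ | _) <;> decide

/-- The last input symbol, the last bit that was popped, and the verdict on the current column. -/
abbrev Register : Type := Option (Option Bool) × Option Bool × Bool

open TM2.Stmt in
/-- The decoder first reads the observed outcome. Then it compares each column with the outcome,
and accepts it if at least half of its nonzero entries are covered by the outcome. -/
def program : Label → TM2.Stmt Alphabet Label Register
  | .load =>
    pop .input (fun v a => (a, v.2)) <|
    branch (fun v => v.1.join.isSome)
      (push .seen (fun v => v.1.join.getD false) <| goto fun _ => .load)
      (load (fun v => (v.1, v.2.1, true)) <| goto fun _ => .rewind)
  | .rewind =>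
    pop .covered (fun v b => (v.1, b, v.2.2)) <|
    -- The unary counters are compared symbol by symbol: the verdict fails once `uncovered` outlasts
    -- `covered`.
    pop .uncovered (fun v b => (v.1, v.2.1, v.2.2 && (b.isNone || v.2.1.isSome))) <|
    pop .seen (fun v b => (v.1, b, v.2.2)) <|
    branch (fun v => v.2.1.isSome)
      (push .outcome (fun v => v.2.1.getD false) <| goto fun _ => .rewind)
      (push .decoded (fun v => v.2.2) <| goto fun _ => .scan)
  | .scan =>
    pop .input (fun v a => (a, v.2)) <|
    pop .outcome (fun v b => (v.1, b, v.2.2)) <|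
    branch (fun v => v.1.isSome)
      (branch (fun v => v.1.join.isSome)
        (push .seen (fun v => v.2.1.getD false) <|
          branch (fun v => v.1.join.getD false)
            (branch (fun v => v.2.1.getD false)
              (push .covered (fun _ => true) <| goto fun _ => .scan)
              (push .uncovered (fun _ => true) <| goto fun _ => .scan))
            (goto fun _ => .scan))
        (load (fun v => (v.1, v.2.1, true)) <| goto fun _ => .rewind))
      (goto fun _ => .discard)
  | .discard =>
    pop .outcome (fun v b => (v.1, b, v.2.2)) <|
    branch (fun v => v.2.1.isSome) (goto fun _ => .discard) (goto fun _ => .emit)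
  | .emit =>
    pop .decoded (fun v b => (v.1, b, v.2.2)) <|
    branch (fun v => v.2.1.isSome)
      (push .output (fun v => v.2.1.getD false) <| goto fun _ => .emit)
      -- The `rewind` after `load` pushes a verdict that belongs to no column. It lies at the bottom
      -- of `decoded`, hence ends on top of `output`, and is dropped here. The register is reset as
      -- `haltList` requires.
      (pop .output (fun _ _ => (none, none, false)) halt)

def machine : FinTM2 where
  K := Stack
  k₀ := .input
  k₁ := .output
  Γ := Alphabet
  Λ := Label
  main := .load
  σ := Register
  initialState := (none, none, false)
  Γk₀Fin := inferInstanceAs (Fintype (Option Bool))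
  m := program

def algorithm : Algorithm where
  tm := machine
  inputAlphabet := Equiv.refl _
  outputAlphabet := Equiv.refl _

theorem finite_alphabet : ∀ k, Finite (Alphabet k) := by
  rintro (_ | _) <;> dsimp only [Alphabet] <;> infer_instance

/-- The contents of all stacks. -/
def contents (i : List (Option Bool)) (o y s p q d : List Bool) : ∀ k, List (Alphabet k)
  | .input => i
  | .output => o
  | .outcome => y
  | .seen => s
  | .covered => p
  | .uncovered => q
  | .decoded => d

section Stacks

variable (i i' : List (Option Bool)) (o y s p q d x : List Bool)

@[simp] theorem contents_input : contents i o y s p q d .input = i := rfl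
@[simp] theorem contents_output : contents i o y s p q d .output = o := rfl
@[simp] theorem contents_outcome : contents i o y s p q d .outcome = y := rfl
@[simp] theorem contents_seen : contents i o y s p q d .seen = s := rfl
@[simp] theorem contents_covered : contents i o y s p q d .covered = p := rfl
@[simp] theorem contents_uncovered : contents i o y s p q d .uncovered = q := rfl
@[simp] theorem contents_decoded : contents i o y s p q d .decoded = d := rfl

@[simp] theorem update_input :
    Function.update (contents i o y s p q d) .input i' = contents i' o y s p q d := by
  funext k; cases k <;> rfl
@[simp] theorem update_output :
    Function.update (contents i o y s p q d) .output x = contents i x y s p q d := by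
  funext k; cases k <;> rfl
@[simp] theorem update_outcome :
    Function.update (contents i o y s p q d) .outcome x = contents i o x s p q d := by
  funext k; cases k <;> rfl
@[simp] theorem update_seen :
    Function.update (contents i o y s p q d) .seen x = contents i o y x p q d := by
  funext k; cases k <;> rfl
@[simp] theorem update_covered :
    Function.update (contents i o y s p q d) .covered x = contents i o y s x q d := by
  funext k; cases k <;> rfl
@[simp] theorem update_uncovered :
    Function.update (contents i o y s p q d) .uncovered x = contents i o y s p x d := by
  funext k; cases k <;> rfl
@[simp] theorem update_decoded :
    Function.update (contents i o y s p q d) .decoded x = contents i o y s p q x := by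
  funext k; cases k <;> rfl

end Stacks

/-- The decoder goes from one configuration to the other in exactly `t` steps. -/
def Runs (t : ℕ) (a b : TM2.Cfg Alphabet Label Register) : Prop :=
  (flip bind (TM2.step program))^[t] (some a) = some b

theorem Runs.trans {t t' : ℕ} {a b c : TM2.Cfg Alphabet Label Register} (h : Runs t a b)
    (h' : Runs t' b c) : Runs (t + t') a c := by
  unfold Runs at *
  rw [add_comm, Function.iterate_add_apply, h, h']

theorem Runs.head {t : ℕ} {l : Label} {v : Register} {S : ∀ k, List (Alphabet k)}
    {b : TM2.Cfg Alphabet Label Register} (h : Runs t (TM2.stepAux (program l) v S) b) :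
    Runs (t + 1) ⟨some l, v, S⟩ b := by
  unfold Runs at *
  rw [Function.iterate_succ_apply]
  exact h

theorem Runs.refl (a : TM2.Cfg Alphabet Label Register) : Runs 0 a a := rfl

theorem runs_load (u : List Bool) (i : List (Option Bool)) (s : List Bool) (v : Register) :
    ∃ a b, Runs (u.length + 1) ⟨some .load, v, contents (u.map some ++ none :: i) [] [] s [] [] []⟩
      ⟨some .rewind, (a, b, true), contents i [] [] (u.reverse ++ s) [] [] []⟩ := by
  induction u generalizing s v with
  | nil =>
    refine ⟨some none, v.2.1, .head ?_⟩
    simpa [program] using Runs.refl _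
  | cons c u ih =>
    obtain ⟨a, b, h⟩ := ih (c :: s) (some (some c), v.2)
    refine ⟨a, b, .head ?_⟩
    simpa [program] using h

/-- The length bounds ensure that restoring the outcome takes enough rounds to empty both counters.
-/
theorem runs_rewind (s y p q d : List Bool) (i : List (Option Bool)) (a : Option (Option Bool))
    (b : Option Bool) (ok : Bool) (hp : p.length ≤ s.length) (hq : q.length ≤ s.length) :
    ∃ v, Runs (s.length + 1) ⟨some .rewind, (a, b, ok), contents i [] y s p q d⟩
      ⟨some .scan, v, contents i [] (s.reverse ++ y) [] [] []
        ((ok && decide (q.length ≤ p.length)) :: d)⟩ := by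
  induction s generalizing y p q b ok with
  | nil =>
    obtain rfl : p = [] := by simpa using hp
    obtain rfl : q = [] := by simpa using hq
    refine ⟨(a, none, ok), .head ?_⟩
    simpa [program] using Runs.refl _
  | cons c s ih =>
    obtain ⟨v, h⟩ := ih (c :: y) p.tail q.tail (some c)
      (ok && (q.head?.isNone || p.head?.isSome)) (by simpa using hp) (by simpa using hq)
    refine ⟨v, .head ?_⟩
    have hok : (ok && (q.head?.isNone || p.head?.isSome) &&
        decide (q.tail.length ≤ p.tail.length)) = (ok && decide (q.length ≤ p.length)) := by
      cases p <;> cases q <;> (simp; try rfl)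
    rw [hok] at h
    simpa [program] using h

/-- Reading one column: `l` lists its entries together with those of the outcome. -/
theorem runs_scan (l : List (Bool × Bool)) (s p q d : List Bool) (i : List (Option Bool))
    (v : Register) :
    ∃ a b p' q', p'.length = p.length + l.countP (fun e => e.1 && e.2) ∧
      q'.length = q.length + l.countP (fun e => e.1 && !e.2) ∧
      Runs (l.length + 1)
        ⟨some .scan, v, contents ((l.map Prod.fst).map some ++ none :: i) [] (l.map Prod.snd) s p q d⟩
        ⟨some .rewind, (a, b, true), contents i [] [] ((l.map Prod.snd).reverse ++ s) p' q' d⟩ := by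
  induction l generalizing s p q v with
  | nil =>
    refine ⟨some none, none, p, q, rfl, rfl, .head ?_⟩
    simpa [program] using Runs.refl _
  | cons e l ih =>
    obtain ⟨e₁, e₂⟩ := e
    obtain ⟨a, b, p', q', hp, hq, h⟩ := ih (e₂ :: s) (if e₁ && e₂ then true :: p else p)
      (if e₁ && !e₂ then true :: q else q) (some (some e₁), some e₂, v.2.2)
    refine ⟨a, b, p', q', ?_, ?_, .head ?_⟩
    · rw [hp, List.countP_cons]
      cases e₁ <;> cases e₂ <;> simp +arith
    · rw [hq, List.countP_cons]
      cases e₁ <;> cases e₂ <;> simp +arith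
    · cases e₁ <;> cases e₂ <;> simpa [program] using h

/-- The majority vote of a column. -/
def vote (y u : List Bool) : Bool :=
  decide ((u.zip y).countP (fun e => e.1 && !e.2) ≤ (u.zip y).countP (fun e => e.1 && e.2))

theorem runs_column (u y d : List Bool) (hu : u.length = y.length) (i : List (Option Bool))
    (v : Register) :
    ∃ v', Runs (2 * (y.length + 1))
      ⟨some .scan, v, contents (u.map some ++ none :: i) [] y [] [] [] d⟩
      ⟨some .scan, v', contents i [] y [] [] [] (vote y u :: d)⟩ := by
  obtain ⟨a, b, p, q, hp, hq, h⟩ := runs_scan (u.zip y) [] [] [] d i v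
  have hlen : (u.zip y).length = y.length := by simp [hu]
  simp only [List.map_fst_zip hu.le, List.map_snd_zip hu.ge, List.append_nil, hlen,
    List.length_nil, zero_add] at h hp hq
  obtain ⟨v', h'⟩ := runs_rewind y.reverse [] p q d i a b true
    (by rw [hp, List.length_reverse, ← hlen]; exact List.countP_le_length)
    (by rw [hq, List.length_reverse, ← hlen]; exact List.countP_le_length)
  refine ⟨v', ?_⟩
  have := h.trans h'
  simp only [hp, hq, List.length_reverse, List.reverse_reverse, List.append_nil,
    Bool.true_and, ← two_mul] at this
  exact this

theorem runs_columns (y : List Bool) (us : List (List Bool)) (hus : ∀ u ∈ us, u.length = y.length)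
    (d : List Bool) (v : Register) :
    ∃ v', Runs (us.length * (2 * (y.length + 1)))
      ⟨some .scan, v, contents (us.map fun u => u.map some ++ [none]).flatten [] y [] [] [] d⟩
      ⟨some .scan, v', contents [] [] y [] [] [] ((us.map (vote y)).reverse ++ d)⟩ := by
  induction us generalizing d v with
  | nil => exact ⟨v, by simpa using Runs.refl _⟩
  | cons u us ih =>
    obtain ⟨v₁, h₁⟩ := runs_column u y d (hus u (by simp))
      (us.map fun u => u.map some ++ [none]).flatten v
    obtain ⟨v₂, h₂⟩ := ih (fun u hu => hus u (by simp [hu])) (vote y u :: d) v₁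
    refine ⟨v₂, ?_⟩
    have := h₁.trans h₂
    rw [add_comm, ← Nat.succ_mul] at this
    simpa using this

theorem runs_discard (y d : List Bool) (v : Register) :
    ∃ v', Runs (y.length + 1) ⟨some .discard, v, contents [] [] y [] [] [] d⟩
      ⟨some .emit, v', contents [] [] [] [] [] [] d⟩ := by
  induction y generalizing v with
  | nil =>
    refine ⟨(v.1, none, v.2.2), .head ?_⟩
    simpa [program] using Runs.refl _
  | cons c y ih =>
    obtain ⟨v', h⟩ := ih (v.1, some c, v.2.2)
    refine ⟨v', .head ?_⟩
    simpa [program] using h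

theorem runs_emit (d o : List Bool) (v : Register) :
    Runs (d.length + 1) ⟨some .emit, v, contents [] o [] [] [] [] d⟩
      ⟨none, (none, none, false), contents [] (d.reverse ++ o).tail [] [] [] [] []⟩ := by
  induction d generalizing v o with
  | nil =>
    refine .head ?_
    simpa [program] using Runs.refl _
  | cons c d ih =>
    refine .head ?_
    simpa [program] using ih (c :: o) (v.1, some c, v.2.2)

theorem runs_decode (y : List Bool) (us : List (List Bool))
    (hus : ∀ u ∈ us, u.length = y.length) :
    ∃ t ≤ us.length * (2 * y.length + 3) + 3 * y.length + 6, Runs t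
      ⟨some .load, (none, none, false),
        contents (y.map some ++ none :: (us.map fun u => u.map some ++ [none]).flatten)
          [] [] [] [] [] []⟩
      ⟨none, (none, none, false), contents [] (us.map (vote y)) [] [] [] [] []⟩ := by
  obtain ⟨a, b, h₁⟩ := runs_load y (us.map fun u => u.map some ++ [none]).flatten []
    (none, none, false)
  obtain ⟨v₂, h₂⟩ := runs_rewind y.reverse [] [] [] []
    (us.map fun u => u.map some ++ [none]).flatten a b true (by simp) (by simp)
  simp only [List.append_nil, List.reverse_reverse, List.length_reverse] at h₁ h₂
  obtain ⟨v₃, h₃⟩ := runs_columns y us hus _ v₂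
  -- On finding the input empty, `scan` has already popped a bit of the outcome, hence `y.tail`.
  have h₄ : Runs 1
      ⟨some .scan, v₃, contents [] [] y [] [] [] ((us.map (vote y)).reverse ++ [true])⟩
      ⟨some .discard, (none, y.head?, v₃.2.2),
        contents [] [] y.tail [] [] [] ((us.map (vote y)).reverse ++ [true])⟩ := by
    refine .head ?_
    simpa [program] using Runs.refl _
  obtain ⟨v₅, h₅⟩ := runs_discard y.tail ((us.map (vote y)).reverse ++ [true])
    (none, y.head?, v₃.2.2)
  have h₆ := runs_emit ((us.map (vote y)).reverse ++ [true]) [] v₅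
  have h := ((((h₁.trans h₂).trans h₃).trans h₄).trans h₅).trans h₆
  have hlen : ((us.map (vote y)).reverse ++ [true]).length = us.length + 1 := by simp
  have htail : y.tail.length ≤ y.length := by simp
  rw [hlen] at h
  refine ⟨_, ?_, by simpa using h⟩
  have : us.length * (2 * y.length + 3) = us.length * (2 * (y.length + 1)) + us.length := by ring
  omega

theorem initList_machine (w : List (Option Bool)) :
    initList machine w = ⟨some .load, (none, none, false), contents w [] [] [] [] [] []⟩ := by
  unfold initList
  congr 1
  funext k
  cases k <;> rfl

theorem haltList_machine (w : List Bool) :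
    haltList machine w = ⟨none, (none, none, false), contents [] w [] [] [] [] []⟩ := by
  unfold haltList
  congr 1
  funext k
  cases k <;> rfl

theorem outputsWithin {m n : ℕ} (A : Matrix (Fin m) (Fin n) Bool) (y : Fin m → Bool) :
    OutputsWithin algorithm (encodeInput A y)
      (List.ofFn fun j => vote (List.ofFn y) (List.ofFn fun i => A i j))
      (n * (2 * m + 3) + 3 * m + 6) := by
  obtain ⟨t, ht, h⟩ := runs_decode (List.ofFn y) (List.ofFn fun j => List.ofFn fun i => A i j)
    (by simp [List.mem_ofFn])
  have hin : encodeInput A y = (List.ofFn y).map some ++ none ::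
      ((List.ofFn fun j => List.ofFn fun i => A i j).map fun u => u.map some ++ [none]).flatten := by
    simp [encodeInput, encodeVec, List.map_ofFn, Function.comp_def]
  have hout : (List.ofFn fun j => vote (List.ofFn y) (List.ofFn fun i => A i j)) =
      (List.ofFn fun j => List.ofFn fun i => A i j).map (vote (List.ofFn y)) := by
    simp [List.map_ofFn, Function.comp_def]
  have hmap_in (w : List (Option Bool)) : w.map algorithm.inputAlphabet.symm = w := List.map_id w
  have hmap_out (w : List Bool) : w.map algorithm.outputAlphabet.symm = w := List.map_id w
  unfold OutputsWithin
  rw [hmap_in, hmap_out, hin, hout]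
  refine ⟨⟨⟨t, ?_⟩, by simpa using ht⟩⟩
  have h' (w : List (Option Bool)) (w' : List Bool)
      (hw : Runs t ⟨some .load, (none, none, false), contents w [] [] [] [] [] []⟩
        ⟨none, (none, none, false), contents [] w' [] [] [] [] []⟩) :
      (flip bind machine.step)^[t] (some (initList machine w)) = some (haltList machine w') := by
    rw [initList_machine, haltList_machine]
    exact hw
  exact h' _ _ h

theorem countP_finRange {n : ℕ} (p : Fin n → Bool) :
    (List.finRange n).countP p = (Finset.univ.filter fun i => p i = true).card := by
  simp [Finset.card, Finset.univ, Fintype.elems, List.countP_eq_length_filter]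

theorem vote_ofFn {m : ℕ} (u y : Fin m → Bool) :
    vote (List.ofFn y) (List.ofFn u) = true ↔
      (Finset.univ.filter fun i => u i = true ∧ y i = false).card ≤
        (Finset.univ.filter fun i => u i = true ∧ y i = true).card := by
  have hzip : (List.ofFn u).zip (List.ofFn y) = (List.finRange m).map fun i => (u i, y i) := by
    rw [List.ofFn_eq_map, List.ofFn_eq_map, List.zip_map', List.map_congr_left fun _ _ => rfl]
  rw [vote, hzip, List.countP_map, List.countP_map, countP_finRange, countP_finRange]
  simp

end MajorityDecoder

end GroupTesting

/-! ### The matrix of an expander and the correctness of majority decoding. -/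

namespace GroupTesting

open Finset

/-- The measurement matrix of a family of `m` functions with `q` values: the row `(i, a)` contains
the arguments at which the `i`-th function has the value `a`. -/
def hashMatrix {m n q : ℕ} (F : Fin m → Fin n → Fin q) : Matrix (Fin (m * q)) (Fin n) Bool :=
  fun r j => decide (F (finProdFinEquiv.symm r).1 j = (finProdFinEquiv.symm r).2)

section HashMatrix

variable {m n q : ℕ} (F : Fin m → Fin n → Fin q)

theorem card_filter_finProdFinEquiv (P : Fin m → Fin q → Prop) [∀ i a, Decidable (P i a)] :
    #{r : Fin (m * q) | P (finProdFinEquiv.symm r).1 (finProdFinEquiv.symm r).2} =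
      ∑ i, #{a | P i a} := by
  simp only [card_filter]
  rw [← Fintype.sum_prod_type' (f := fun i a => if P i a then 1 else 0)]
  exact Equiv.sum_comp finProdFinEquiv.symm fun x : Fin m × Fin q => if P x.1 x.2 then 1 else 0

theorem card_column (j : Fin n) : #{r | hashMatrix F r j = true} = m := by
  have := card_filter_finProdFinEquiv fun i a => F i j = a
  simpa [hashMatrix, filter_eq] using this

theorem card_rows (T : Finset (Fin n)) :
    #(T.biUnion fun j => {r | hashMatrix F r j = true}) = ∑ i, #(T.image (F i)) := by
  have := card_filter_finProdFinEquiv fun i a => ∃ j ∈ T, F i j = a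
  have hrows : (T.biUnion fun j => {r | hashMatrix F r j = true}) =
      ({r | ∃ j ∈ T, F (finProdFinEquiv.symm r).1 j = (finProdFinEquiv.symm r).2} :
        Finset (Fin (m * q))) := by
    ext r
    simp [hashMatrix]
  rw [hrows, this]
  refine sum_congr rfl fun i _ => congrArg card ?_
  ext a
  simp

end HashMatrix

/-- The decoding of `y` by majority vote: a column is accepted if at least half of its nonzero
entries are covered by `y`. -/
def majorityDecoding {m n : ℕ} (A : Matrix (Fin m) (Fin n) Bool) (y : Fin m → Bool) :
    Fin n → Bool :=
  fun j => MajorityDecoder.vote (List.ofFn y) (List.ofFn fun i => A i j)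

theorem card_filter_and_add_card_filter_and_not {m : ℕ} (u y : Fin m → Bool) :
    #{i | u i = true ∧ y i = true} + #{i | u i = true ∧ y i = false} = #{i | u i = true} := by
  rw [← card_filter_add_card_filter_not (s := {i | u i = true}) (fun i => y i = true),
    filter_filter, filter_filter]
  simp

theorem isValidDecoding_majorityDecoding {m n q d k E : ℕ} (F : Fin m → Fin n → Fin q)
    {δ e₀ e₁ : ℝ}
    (hF : ∀ T : Finset (Fin n), T.Nonempty → #T ≤ k →
      E * ∑ i, (#T - #(T.image (F i))) < m * #T)
    (hk : d + ⌊δ⌋₊ + 1 ≤ k) (hE : 4 * k ≤ E * (⌊δ⌋₊ + 1))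
    (he₀ : E * e₀ ≤ k * m) (he₁ : 2 * e₁ ≤ m) (hδ : 0 ≤ δ) (y : Fin (m * q) → Bool) :
    IsValidDecoding (hashMatrix F) d e₀ e₁ δ 0 y (majorityDecoding (hashMatrix F) y) := by
  rintro x hx hfar ⟨hy₀, hy₁⟩
  set A := hashMatrix F
  have hcol : ∀ j, #{r | A r j = true ∧ y r = true} + #{r | A r j = true ∧ y r = false} = m :=
    fun j => (card_filter_and_add_card_filter_and_not _ y).trans (card_column F j)
  refine hfar ⟨?_, ?_⟩
  · by_contra! hlt
    have hcard : ⌊δ⌋₊ + 1 ≤ #{j | x j = false ∧ majorityDecoding A y j = true} :=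
      (Nat.floor_lt hδ).2 hlt
    -- The size of `S` is cut down so that `X ∪ S` has at most `k` elements and expansion applies.
    obtain ⟨S, hS, hScard⟩ := exists_subset_card_eq hcard
    set X : Finset (Fin n) := {j | x j = true}
    have hdisj : Disjoint X S := by
      refine disjoint_left.2 fun j hjX hjS => ?_
      have h₁ := (mem_filter.1 hjX).2
      have h₂ := (mem_filter.1 (hS hjS)).2.1
      simp [h₁] at h₂
    have hTcard : #(X ∪ S) = #X + (⌊δ⌋₊ + 1) := by rw [card_union_of_disjoint hdisj, hScard]
    have hXd : #X ≤ d := hx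
    have hexp := hF (X ∪ S) (card_pos.1 (by omega)) (by omega)
    have hsplit : ∑ i, (#(X ∪ S) - #((X ∪ S).image (F i))) + ∑ i, #((X ∪ S).image (F i)) =
        m * (#X + (⌊δ⌋₊ + 1)) := by
      rw [← sum_add_distrib, sum_congr rfl fun i _ => Nat.sub_add_cancel card_image_le, hTcard]
      simp
    -- A row met by `X ∪ S` is met by `X`, or is a flip from 0 to 1, or is a one of a column in `S`
    -- that `y` misses.
    have hcover : #((X ∪ S).biUnion fun j => {r | A r j = true}) ≤
        #(X.biUnion fun j => {r | A r j = true}) +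
        #{r | outcome A x r = false ∧ y r = true} +
        ∑ j ∈ S, #{r | A r j = true ∧ y r = false} := by
      refine le_trans (card_le_card ?_) <| (card_union_le _ _).trans <|
        Nat.add_le_add (card_union_le _ _) card_biUnion_le
      intro r hr
      obtain ⟨j, hj, hr⟩ := mem_biUnion.1 hr
      replace hr := (mem_filter.1 hr).2
      simp only [mem_union, mem_biUnion, mem_filter, mem_univ, true_and]
      by_cases hX : ∃ j ∈ X, A r j = true
      · exact .inl (.inl hX)
      · have hjS : j ∈ S := (mem_union.1 hj).resolve_left fun h => hX ⟨j, h, hr⟩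
        cases hyr : y r
        · exact .inr ⟨j, hjS, hr, rfl⟩
        · refine .inl (.inr ⟨decide_eq_false ?_, rfl⟩)
          rintro ⟨j', hj', hr'⟩
          exact hX ⟨j', by simp [X, hj'], hr'⟩
    have hXrows : #(X.biUnion fun j => {r | A r j = true}) ≤ m * #X := by
      rw [card_rows]
      exact (sum_le_sum fun i _ => card_image_le).trans (by simp)
    have hSrows : 2 * ∑ j ∈ S, #{r | A r j = true ∧ y r = false} ≤ (⌊δ⌋₊ + 1) * m := by
      rw [mul_sum]
      refine (sum_le_card_nsmul S _ m fun j hj => ?_).trans_eq (by rw [hScard, smul_eq_mul])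
      have hvote := (mem_filter.1 (hS hj)).2.2
      rw [majorityDecoding, MajorityDecoder.vote_ofFn] at hvote
      have := hcol j
      omega
    rw [card_rows] at hcover
    have herr : E * #{r | outcome A x r = false ∧ y r = true} ≤ k * m := by
      have : (E * #{r | outcome A x r = false ∧ y r = true} : ℝ) ≤ k * m :=
        (mul_le_mul_of_nonneg_left hy₀ E.cast_nonneg).trans he₀
      exact_mod_cast this
    have hmT : m * #(X ∪ S) ≤ m * k := Nat.mul_le_mul_left _ (by omega)
    have hEm := Nat.mul_le_mul_right m hE
    have hfew : m * (⌊δ⌋₊ + 1) ≤ 2 * ∑ i, (#(X ∪ S) - #((X ∪ S).image (F i))) +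
        2 * #{r | outcome A x r = false ∧ y r = true} := by
      rw [mul_add m] at hsplit
      rw [mul_comm _ m] at hSrows
      omega
    -- After scaling by `E`, the left side is at least `4 * k * m`; on the right, collisions give
    -- less than `2 * k * m` and errors at most `2 * k * m`.
    have := Nat.mul_le_mul_left E hfew
    linarith
  · rw [← Nat.cast_zero, Nat.cast_le, Nat.le_zero, card_eq_zero, filter_eq_empty_iff]
    rintro j - ⟨hxj, hzj⟩
    have hvote : ¬ majorityDecoding A y j = true := by simp [hzj]
    rw [majorityDecoding, MajorityDecoder.vote_ofFn, not_le] at hvote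
    -- Every one of a column in the support of `x` that `y` misses is a flip from 1 to 0.
    have hsub : #{r | A r j = true ∧ y r = false} ≤
        #{r | outcome A x r = true ∧ y r = false} := by
      refine card_le_card (monotone_filter_right _ ?_)
      rintro r - ⟨h₁, h₂⟩
      exact ⟨decide_eq_true ⟨j, hxj, h₁⟩, h₂⟩
    have h := hcol j
    have : m + 1 ≤ 2 * #{r | outcome A x r = true ∧ y r = false} := by omega
    have : (m + 1 : ℝ) ≤ 2 * #{r | outcome A x r = true ∧ y r = false} := by exact_mod_cast this
    linarith

theorem isCorrecting_and_reconstructs {m n d : ℕ} (A : Matrix (Fin m) (Fin n) Bool)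
    {e₀ e₁ e₀' e₁' : ℝ} (hm : 0 < m) (hn : 0 < n)
    (h : ∀ y, IsValidDecoding A d e₀ e₁ e₀' e₁' y (majorityDecoding A y)) :
    IsCorrecting A d e₀ e₁ e₀' e₁' ∧
      Reconstructs MajorityDecoder.algorithm A d e₀ e₁ e₀' e₁' (14 * (m * n)) := by
  refine ⟨fun y => ⟨_, h y⟩, fun y => ⟨_, h y, ?_⟩⟩
  obtain ⟨r⟩ := MajorityDecoder.outputsWithin A y
  refine ⟨⟨r.toEvalsTo, r.steps_le_m.trans ?_⟩⟩
  -- Each term of `2mn + 3n + 3m + 6` is bounded by a multiple of `mn`, and `2 + 3 + 3 + 6 = 14`.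
  have : n ≤ m * n := Nat.le_mul_of_pos_left n hm
  have : m ≤ m * n := Nat.le_mul_of_pos_right m hn
  linarith

theorem exists_two_mul_le_two_pow {N : ℕ} (hN : 2 ≤ N) :
    ∃ m : ℕ, 0 < m ∧ 2 * N ≤ 2 ^ m ∧ (m : ℝ) ≤ 5 * Real.log N := by
  refine ⟨Nat.log 2 N + 2, by omega, ?_, ?_⟩
  · rw [pow_succ']
    exact Nat.mul_le_mul_left 2 (Nat.lt_pow_succ_log_self one_lt_two N).le
  · have h₁ : Real.log (2 ^ Nat.log 2 N) ≤ Real.log N :=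
      Real.log_le_log (by positivity) (by exact_mod_cast Nat.pow_log_le_self 2 (by omega))
    have h₂ : Real.log 2 ≤ Real.log N := Real.log_le_log two_pos (by exact_mod_cast hN)
    rw [Real.log_pow] at h₁
    -- From `log 2 > 2 / 3`, the two summands of `m` are at most `1.5 log N` and `3 log N`.
    have h₃ := Real.log_two_gt_d9
    have h₄ : (Nat.log 2 N : ℝ) * (2 / 3) ≤ Nat.log 2 N * Real.log 2 := by
      gcongr
      linarith
    push_cast
    linarith

end GroupTesting

/-! ### Choice of the constants. -/

theorem corollary2 (δ : ℝ) (hδ : 0 < δ) :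
    ∃ (C p ν : ℝ) (c : ℕ) (R : GroupTesting.Algorithm),
      0 < p ∧ 0 < ν ∧ (∀ k, Finite (R.tm.Γ k)) ∧
      ∀ N D : ℕ, 2 ≤ N → 1 ≤ D → D ≤ N →
        ∃ (M : ℕ) (A : Matrix (Fin M) (Fin N) Bool),
          (M : ℝ) ≤ C * (D * Real.log N) ∧
          GroupTesting.IsCorrecting A D (p * M) (ν / D * M) (δ * D) 0 ∧
          GroupTesting.Reconstructs R A D (p * M) (ν / D * M) (δ * D) 0 (c * (M * N)) := by
  -- With `s = ⌊δ D⌋ + 1 ≥ δ D`, this gives `4 k = 4 D + 4 s ≤ E s`. The choice of `p` makes `p M =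
  -- k m / E`; that of `ν` makes `ν M / D ≤ m / 2`, because `k ≤ (δ + 2) D`.
  obtain ⟨E, hE⟩ := exists_nat_ge (4 / δ + 4)
  have hE0 : (0 : ℝ) < E := lt_of_lt_of_le (by positivity) hE
  refine ⟨5 * ((δ + 2) * 4 ^ E), 1 / (E * 4 ^ E), 1 / (2 * ((δ + 2) * 4 ^ E)), 14,
    GroupTesting.MajorityDecoder.algorithm, by positivity, by positivity,
    GroupTesting.MajorityDecoder.finite_alphabet, fun N D hN hD _ => ?_⟩
  have hD1 : (1 : ℝ) ≤ D := by exact_mod_cast hD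
  have hδD : 0 ≤ δ * D := by positivity
  obtain ⟨m, hm, hmN, hmlog⟩ := GroupTesting.exists_two_mul_le_two_pow hN
  obtain ⟨k, hk⟩ : ∃ k, k = D + ⌊δ * D⌋₊ + 1 := ⟨_, rfl⟩
  have hkD : (k : ℝ) ≤ (δ + 2) * D := by
    have := Nat.floor_le hδD
    rw [hk]
    push_cast
    linarith
  obtain ⟨F, hF⟩ := GroupTesting.exists_few_collisions (α := Fin N) (β := Fin (k * 4 ^ E)) m k E
    (by omega) (by simpa using hmN) (Fintype.card_fin _)
  have hk0 : 0 < k := by omega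
  refine ⟨m * (k * 4 ^ E), GroupTesting.hashMatrix F, ?_,
    GroupTesting.isCorrecting_and_reconstructs _ (by positivity) (by omega) fun y =>
      GroupTesting.isValidDecoding_majorityDecoding F hF hk.ge ?_ ?_ ?_ hδD y⟩
  · push_cast
    calc (m : ℝ) * (k * 4 ^ E) ≤ (5 * Real.log N) * ((δ + 2) * D * 4 ^ E) := by gcongr
      _ = _ := by ring
  · have hs : δ * D ≤ (⌊δ * D⌋₊ + 1 : ℝ) := (Nat.lt_floor_add_one _).le
    have h4 : (4 * D : ℝ) ≤ 4 / δ * (⌊δ * D⌋₊ + 1) := by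
      calc (4 * D : ℝ) = 4 / δ * (δ * D) := by field_simp
        _ ≤ _ := by gcongr
    have : (4 * k : ℝ) ≤ E * (⌊δ * D⌋₊ + 1) := by
      calc (4 * k : ℝ) = 4 * D + 4 * (⌊δ * D⌋₊ + 1) := by rw [hk]; push_cast; ring
        _ ≤ (4 / δ + 4) * (⌊δ * D⌋₊ + 1) := by linarith
        _ ≤ _ := by gcongr
    exact_mod_cast this
  · push_cast
    apply le_of_eq
    field_simp
  · push_cast
    calc 2 * (1 / (2 * ((δ + 2) * 4 ^ E)) / D * (m * (k * 4 ^ E))) =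
        (m : ℝ) * (k / ((δ + 2) * D)) := by field_simp
      _ ≤ m * 1 := by
        gcongr
        exact (div_le_one (by positivity)).2 hkD
      _ = m := mul_one _
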